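/- Let $p\in(0,1)$ and put $q=1-p$. For real $r>0$, let $\mathrm{NegBin}(r,p)$ denote the probability distribution on $\mathbb{N}_0=\{0,1,2,\dots\}$ with mass function $$P_{r,p}(k)=\frac{\Gamma(r+k)}{\Gamma(r)\,k!}\,q^r p^k,\qquad k\in\mathbb{N}_0 .$$ Let $K\sim\mathrm{NegBin}(r,p)$ and $U\sim\mathrm{Uniform}(-\tfrac12,\tfrac12)$ be independent, let $X:=K+U$, and let $\mathbb{P}_{r,p}$ and $\widetilde{\mathbb{P}}_{r,p}$ be the laws of $K$ and $X$, respectively. Then, for every $r>0$ and every Borel set $B\subseteq\mathbb{R}$, $$\widetilde{\mathbb{P}}_{r,p}(B)=\int_{\mathbb{N}_0}\int_{(-\frac12,\frac12)}\mathbf{1}_B(k+u)\,\mathrm{d}u\,\mathbb{P}_{r,p}(\mathrm{d}k).$$ Moreover, let $\mathbb{Q}_{r,p}$ be the law of a $\mathrm{Normal}(rpq^{-1},\,rpq^{-2})$ random variable (mean $rpq^{-1}$, variance $rpq^{-2}$). There exist constants $C_p>0$ and $r_p>0$, depending only on $p$, such that for all real $r\ge r_p$, $$\|\widetilde{\mathbb{P}}_{r,p}-\mathbb{Q}_{r,p}\|\le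 C_p\, r^{-1/2},$$ where $\|\cdot\|$ denotes the total variation norm of a finite signed measure, $\|\mu\|=|\mu|(\mathbb{R})$. -/

import Mathlib

open MeasureTheory ProbabilityTheory

/-- The negative binomial mass function
`P_{r,p}(k) = Γ(r + k) / (Γ(r) k!) * (1 - p)^r * p^k`, with real parameter `r > 0`. -/
noncomputable def negBinPMFReal (r p : ℝ) (k : ℕ) : ℝ :=
  Real.Gamma (r + k) / (Real.Gamma r * (k.factorial : ℝ)) * (1 - p) ^ r * p ^ k

/-- The negative binomial distribution `NegBin(r, p)`, as a measure on `ℕ`. -/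
noncomputable def negBinMeasure (r p : ℝ) : Measure ℕ :=
  Measure.sum fun k => ENNReal.ofReal (negBinPMFReal r p k) • Measure.dirac k

/-- The total variation norm `|s|(α)` of a finite signed measure `s`. -/
noncomputable def tvNorm {α : Type*} [MeasurableSpace α] (s : SignedMeasure α) : ℝ :=
  s.totalVariation.real Set.univ

theorem Gamma_add_nat_eq_mul_choose {r : ℝ} (hr : 0 < r) (k : ℕ) :
    Real.Gamma (r + k) / (Real.Gamma r * (k.factorial : ℝ)) = Ring.choose (r + k - 1) k := by
  have hG := (Real.Gamma_pos_of_pos hr).ne'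
  have hk : (k.factorial : ℝ) ≠ 0 := by exact_mod_cast k.factorial_ne_zero
  have h1 : ∀ n : ℕ, Real.Gamma (r + n) = (ascPochhammer ℝ n).eval r * Real.Gamma r := by
    intro n
    induction n with
    | zero => simp
    | succ n ih =>
      have h2 : r + n ≠ 0 := by positivity
      rw [Nat.cast_succ, ← add_assoc, Real.Gamma_add_one h2, ih, ascPochhammer_succ_eval]
      ring
  have h3 := Ring.factorial_nsmul_multichoose_eq_ascPochhammer r k
  rw [Polynomial.ascPochhammer_smeval_eq_eval, nsmul_eq_mul] at h3
  rw [h1, ← h3, ← Ring.multichoose_eq]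
  field_simp

theorem hasSum_negBinPMFReal {r p : ℝ} (hr : 0 < r) (hp0 : 0 < p) (hp1 : p < 1) :
    HasSum (negBinPMFReal r p) 1 := by
  have h := (Real.one_div_one_sub_rpow_hasFPowerSeriesOnBall_zero r).hasSum (y := p)
    (by simpa [← ofReal_norm, abs_of_pos hp0] using hp1)
  have hq : (0 : ℝ) < (1 - p) ^ r := Real.rpow_pos_of_pos (by linarith) r
  have h2 := h.mul_left ((1 - p) ^ r)
  simp only [zero_add, mul_one_div_cancel hq.ne'] at h2
  have h3 : negBinPMFReal r p = fun k => (1 - p) ^ r *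
      (FormalMultilinearSeries.ofScalars ℝ (fun n : ℕ => Ring.choose (r + n - 1) n) k)
        fun _ => p := by
    funext k
    rw [negBinPMFReal, Gamma_add_nat_eq_mul_choose hr]
    simp
    ring
  rw [h3]
  exact h2

theorem isProbabilityMeasure_negBinMeasure {r p : ℝ} (hr : 0 < r) (hp0 : 0 < p) (hp1 : p < 1) :
    IsProbabilityMeasure (negBinMeasure r p) := by
  refine (hasSum_negBinPMFReal hr hp0 hp1).isProbabilityMeasure_sum_dirac fun k => ?_
  have h1 := Real.Gamma_pos_of_pos hr
  have h2 : 0 < Real.Gamma (r + k) := Real.Gamma_pos_of_pos (by positivity)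
  have h3 : (0 : ℝ) ≤ (1 - p) ^ r := Real.rpow_nonneg (by linarith) r
  unfold negBinPMFReal
  positivity

/-!
Stein's method, applied without standardizing. Let `q = 1 - p`, `m = r p / q` and
`v = r p / q ^ 2`. For `h` continuous with `|h| ≤ 1`, the Gaussian Stein equation
`v F' - (x - m) F = h - ∫ h d𝒩(m, v)` has a `C¹` solution `F` with `|F| = O(v ^ (-1/2))` and
`|F'| = O(1 / v)`, by the Mills ratio bounds for the Gaussian tail. The integral of the left-hand
side over the cell `(k - 1/2, k + 1/2)` differs by at most `‖F'‖ |k - m| / q + ‖F‖ / 2` from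
`(p (r + k) F(k + 1/2) - k F(k - 1/2)) / q`. The mean of the latter under `NegBin(r, p)` vanishes:
this is the negative binomial Stein identity `E[p (r + K) g(K + 1)] = E[K g(K)]` with
`g k = F(k - 1/2)`. As `E|K - m| ≤ √(Var K) = √v`, the error is `O(v ^ (-1/2)) = O(r ^ (-1/2))`.
-/

section TotalVariation

variable {α : Type*} [MeasurableSpace α]

theorem exists_tvNorm_eq_integral_sub (μ ν : Measure α) [IsFiniteMeasure μ] [IsFiniteMeasure ν] :
    ∃ σ : α → ℝ, Measurable σ ∧ (∀ x, |σ x| ≤ 1) ∧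
      tvNorm (μ.toSignedMeasure - ν.toSignedMeasure) = ∫ x, σ x ∂μ - ∫ x, σ x ∂ν := by
  obtain ⟨i, hi, hi0, hic, hpos, hneg⟩ :=
    (μ.toSignedMeasure - ν.toSignedMeasure).toJordanDecomposition_spec
  have hσ (ρ : Measure α) [IsFiniteMeasure ρ] :
      ∫ x, (i.indicator 1 x - iᶜ.indicator 1 x : ℝ) ∂ρ = ρ.real i - ρ.real iᶜ := by
    rw [integral_sub ((integrable_const 1).indicator hi) ((integrable_const 1).indicator hi.compl),
      integral_indicator_one hi, integral_indicator_one hi.compl]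
  refine ⟨fun x => i.indicator 1 x - iᶜ.indicator 1 x, by measurability, fun x => ?_, ?_⟩
  · by_cases hx : x ∈ i <;> simp [hx]
  · rw [hσ, hσ, tvNorm, SignedMeasure.totalVariation, measureReal_add_apply, hpos, hneg,
      SignedMeasure.toMeasureOfZeroLE_real_apply _ hi0 hi .univ,
      SignedMeasure.toMeasureOfLEZero_real_apply _ hic hi.compl .univ, Set.inter_univ,
      Set.inter_univ, Measure.toSignedMeasure_sub_apply hi,
      Measure.toSignedMeasure_sub_apply hi.compl]
    ring

variable [TopologicalSpace α] [NormalSpace α] [BorelSpace α]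

theorem exists_continuous_abs_le_one_integral_abs_sub_le (ρ : Measure α) [IsFiniteMeasure ρ]
    [ρ.WeaklyRegular] {σ : α → ℝ} (hσ : Measurable σ) (hσ1 : ∀ x, |σ x| ≤ 1) {δ : ℝ}
    (hδ : 0 < δ) : ∃ f : α → ℝ, Continuous f ∧ (∀ x, |f x| ≤ 1) ∧ ∫ x, |σ x - f x| ∂ρ ≤ δ := by
  have hσi : Integrable σ ρ := .of_bound hσ.aestronglyMeasurable 1 (.of_forall hσ1)
  obtain ⟨g, hg, hgi⟩ := hσi.exists_boundedContinuous_integral_sub_le hδ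
  have h11 : (-1 : ℝ) ≤ 1 := by norm_num
  have hfc : Continuous fun x => (Set.projIcc (-1 : ℝ) 1 h11 (g x) : ℝ) := by fun_prop
  have hf1 (x : α) : |(Set.projIcc (-1 : ℝ) 1 h11 (g x) : ℝ)| ≤ 1 :=
    abs_le.mpr (Set.projIcc (-1 : ℝ) 1 h11 (g x)).2
  refine ⟨_, hfc, hf1, (integral_mono ?_ (hσi.sub hgi).norm fun x => ?_).trans hg⟩
  · exact (hσi.sub (.of_bound hfc.aestronglyMeasurable 1 (.of_forall hf1))).abs
  · have hproj := Set.abs_projIcc_sub_projIcc h11 (c := σ x) (d := g x)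
    rwa [Set.projIcc_of_mem h11 (abs_le.mp (hσ1 x))] at hproj

theorem tvNorm_le_of_forall_continuous {μ ν : Measure α} [IsFiniteMeasure μ] [IsFiniteMeasure ν]
    [(μ + ν).WeaklyRegular] {ε : ℝ}
    (h : ∀ f : α → ℝ, Continuous f → (∀ x, |f x| ≤ 1) → |∫ x, f x ∂μ - ∫ x, f x ∂ν| ≤ ε) :
    tvNorm (μ.toSignedMeasure - ν.toSignedMeasure) ≤ ε := by
  obtain ⟨σ, hσ, hσ1, htv⟩ := exists_tvNorm_eq_integral_sub μ ν
  refine le_of_forall_pos_le_add fun δ hδ => ?_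
  obtain ⟨f, hf, hf1, hσf⟩ :=
    exists_continuous_abs_le_one_integral_abs_sub_le (μ + ν) hσ hσ1 hδ
  have integrable_σ (ρ : Measure α) [IsFiniteMeasure ρ] : Integrable σ ρ :=
    .of_bound hσ.aestronglyMeasurable 1 (.of_forall hσ1)
  have integrable_f (ρ : Measure α) [IsFiniteMeasure ρ] : Integrable f ρ :=
    .of_bound hf.aestronglyMeasurable 1 (.of_forall hf1)
  have happrox (ρ : Measure α) [IsFiniteMeasure ρ] :
      |∫ x, σ x ∂ρ - ∫ x, f x ∂ρ| ≤ ∫ x, |σ x - f x| ∂ρ := by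
    rw [← integral_sub (integrable_σ ρ) (integrable_f ρ)]
    exact abs_integral_le_integral_abs
  have integrable_abs_sub (ρ : Measure α) [IsFiniteMeasure ρ] :
      Integrable (fun x => |σ x - f x|) ρ := ((integrable_σ ρ).sub (integrable_f ρ)).abs
  rw [integral_add_measure (integrable_abs_sub μ) (integrable_abs_sub ν)] at hσf
  have hμ := (abs_le.mp (happrox μ)).2
  have hν := (abs_le.mp (happrox ν)).1
  have hfμν := (abs_le.mp (h f hf hf1)).2
  linarith

end TotalVariation

section GaussianTail

variable {m : ℝ} {v : NNReal}

theorem continuous_gaussianPDFReal (m : ℝ) (v : NNReal) : Continuous (gaussianPDFReal m v) := by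
  unfold gaussianPDFReal
  fun_prop

theorem hasDerivAt_gaussianPDFReal (m : ℝ) (v : NNReal) (x : ℝ) :
    HasDerivAt (gaussianPDFReal m v) (-((x - m) / v) * gaussianPDFReal m v x) x := by
  have hexponent : HasDerivAt (fun y => -(y - m) ^ 2 / (2 * v)) (-((x - m) / v)) x := by
    refine ((((hasDerivAt_id x).sub_const m).pow 2).neg.div_const _).congr_deriv ?_
    push_cast [id_eq]
    ring
  refine (hexponent.exp.const_mul _).congr_deriv ?_
  rw [gaussianPDFReal]
  ring

theorem gaussianPDFReal_add_abs_sub (m : ℝ) (v : NNReal) (x : ℝ) :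
    gaussianPDFReal m v (m + |x - m|) = gaussianPDFReal m v x := by
  simp only [gaussianPDFReal, add_sub_cancel_left, sq_abs]

theorem integrable_sub_mul_gaussianPDFReal (m : ℝ) (hv : v ≠ 0) :
    Integrable fun x => (x - m) * gaussianPDFReal m v x := by
  have hid : Integrable (fun x => x - m) (gaussianReal m v) :=
    ((memLp_id_gaussianReal 1).integrable le_rfl).sub (integrable_const m)
  rw [gaussianReal_of_var_ne_zero m hv, integrable_withDensity_iff_integrable_smul'
    (measurable_gaussianPDF m v) (.of_forall fun _ => gaussianPDF_lt_top)] at hid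
  simpa only [toReal_gaussianPDF, smul_eq_mul, mul_comm] using hid

theorem integral_Ioi_sub_mul_gaussianPDFReal (hv : v ≠ 0) (a : ℝ) :
    ∫ x in Set.Ioi a, (x - m) * gaussianPDFReal m v x = v * gaussianPDFReal m v a := by
  have hint := (integrable_sub_mul_gaussianPDFReal m hv).integrableOn (s := Set.Ioi a)
  have hderiv (x : ℝ) :
      HasDerivAt (fun x => -(v * gaussianPDFReal m v x)) ((x - m) * gaussianPDFReal m v x) x := by
    refine ((hasDerivAt_gaussianPDFReal m v x).const_mul (v : ℝ)).neg.congr_deriv ?_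
    field_simp
  have hlim := tendsto_zero_of_hasDerivAt_of_integrableOn_Ioi (fun x _ => hderiv x) hint
    ((integrable_gaussianPDFReal m v).const_mul (v : ℝ)).neg.integrableOn
  rw [integral_Ioi_of_hasDerivAt_of_tendsto' (fun x _ => hderiv x) hint hlim]
  ring

theorem sub_mul_integral_Ioi_gaussianPDFReal_le (hv : v ≠ 0) (a : ℝ) :
    (a - m) * ∫ x in Set.Ioi a, gaussianPDFReal m v x ≤ v * gaussianPDFReal m v a := by
  rw [← integral_Ioi_sub_mul_gaussianPDFReal hv a, ← integral_const_mul]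
  refine setIntegral_mono_on ((integrable_gaussianPDFReal m v).const_mul _).integrableOn
    (integrable_sub_mul_gaussianPDFReal m hv).integrableOn measurableSet_Ioi fun x hx => ?_
  gcongr
  · exact gaussianPDFReal_nonneg m v x
  · exact (Set.mem_Ioi.mp hx).le

theorem gaussianPDFReal_add_le (v : NNReal) {a y : ℝ} (ha : m ≤ a) (hy : 0 ≤ y) :
    gaussianPDFReal m v (a + y) ≤
      gaussianPDFReal m v a * Real.exp (-(1 / (2 * v)) * y ^ 2) := by
  have hsq : (a - m) ^ 2 + y ^ 2 ≤ (a + y - m) ^ 2 := by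
    nlinarith [mul_nonneg hy (sub_nonneg.mpr ha)]
  rw [gaussianPDFReal, gaussianPDFReal, mul_assoc _ (Real.exp _), ← Real.exp_add,
    show -(a - m) ^ 2 / (2 * v) + -(1 / (2 * v)) * y ^ 2 =
      -((a - m) ^ 2 + y ^ 2) / (2 * (v : ℝ)) by ring]
  gcongr

theorem integral_Ioi_gaussianPDFReal_le (hv : v ≠ 0) {a : ℝ} (ha : m ≤ a) :
    ∫ x in Set.Ioi a, gaussianPDFReal m v x ≤
      √(Real.pi / 2 * v) * gaussianPDFReal m v a := by
  have hshift : ∫ x in Set.Ioi a, gaussianPDFReal m v x =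
      ∫ y in Set.Ioi 0, gaussianPDFReal m v (a + y) := by
    rw [← (measurePreserving_add_left volume a).setIntegral_preimage_emb
      (measurableEmbedding_addLeft a) (gaussianPDFReal m v) (Set.Ioi a)]
    simp
  have : (0 : ℝ) < v := NNReal.coe_pos.mpr hv.bot_lt
  have hconst : √(Real.pi / (1 / (2 * v))) / 2 = √(Real.pi / 2 * v) := by
    rw [show Real.pi / (1 / (2 * v)) = Real.pi / 2 * v * 2 ^ 2 by field_simp,
      Real.sqrt_mul (by positivity), Real.sqrt_sq two_pos.le, mul_div_cancel_right₀ _ two_ne_zero]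
  calc ∫ x in Set.Ioi a, gaussianPDFReal m v x
      = ∫ y in Set.Ioi 0, gaussianPDFReal m v (a + y) := hshift
    _ ≤ ∫ y in Set.Ioi 0, gaussianPDFReal m v a * Real.exp (-(1 / (2 * v)) * y ^ 2) :=
        setIntegral_mono_on ((integrable_gaussianPDFReal m v).comp_add_left a).integrableOn
          ((integrable_exp_neg_mul_sq (by positivity)).const_mul _).integrableOn
          measurableSet_Ioi
          fun y hy => gaussianPDFReal_add_le v ha (Set.mem_Ioi.mp hy).le
    _ = √(Real.pi / 2 * v) * gaussianPDFReal m v a := by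
        rw [integral_const_mul, integral_gaussian_Ioi, hconst, mul_comm]

theorem integral_Iic_gaussianPDFReal (m : ℝ) (v : NNReal) (x : ℝ) :
    ∫ t in Set.Iic x, gaussianPDFReal m v t =
      ∫ t in Set.Ioi (2 * m - x), gaussianPDFReal m v t := by
  have hsymm (t : ℝ) : gaussianPDFReal m v (2 * m - t) = gaussianPDFReal m v t := by
    simp only [gaussianPDFReal]
    ring_nf
  have hreflect := (Measure.measurePreserving_sub_left volume (2 * m)).setIntegral_preimage_emb
    (MeasurableEquiv.subLeft (2 * m)).measurableEmbedding (gaussianPDFReal m v) (Set.Iio x)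
  rw [integral_Iic_eq_integral_Iio, ← hreflect]
  simp only [hsymm, Set.preimage_const_sub_Iio]

end GaussianTail

/-- The Stein operator `F ↦ v F' - (x - m) F` of the Gaussian distribution with mean `m` and
variance `v`; its image has zero Gaussian mean. -/
noncomputable def gaussianSteinOp (m v : ℝ) (F : ℝ → ℝ) (x : ℝ) : ℝ :=
  v * deriv F x - (x - m) * F x

/-- The bounded solution `f` of the Gaussian Stein equation `v f' - (x - m) f = w`, for a
right-hand side `w` of zero Gaussian mean. -/
noncomputable def gaussianSteinSolution (m : ℝ) (v : NNReal) (w : ℝ → ℝ) (x : ℝ) : ℝ :=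
  (∫ t in Set.Iic x, gaussianPDFReal m v t * w t) / (v * gaussianPDFReal m v x)

section SteinSolution

variable {m : ℝ} {v : NNReal} {w : ℝ → ℝ} {D : ℝ}

theorem hasDerivAt_integral_Iic {g : ℝ → ℝ} (hg : Continuous g) (hgi : Integrable g) (x : ℝ) :
    HasDerivAt (fun y => ∫ t in Set.Iic y, g t) (g x) x := by
  have hsplit (y : ℝ) :
      ∫ t in Set.Iic y, g t = (∫ t in Set.Iic 0, g t) + ∫ t in (0 : ℝ)..y, g t :=
    sub_eq_iff_eq_add'.mp
      (intervalIntegral.integral_Iic_sub_Iic hgi.integrableOn hgi.integrableOn)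
  refine HasDerivAt.congr_of_eventuallyEq ?_ (.of_forall hsplit)
  exact (hg.integral_hasStrictDerivAt 0 x).hasDerivAt.const_add _

theorem integrable_gaussianPDFReal_mul (m : ℝ) (v : NNReal) (hw : Continuous w)
    (hwD : ∀ x, |w x| ≤ D) : Integrable fun t => gaussianPDFReal m v t * w t :=
  (integrable_gaussianPDFReal m v).mul_bdd hw.aestronglyMeasurable (.of_forall hwD)

theorem abs_setIntegral_gaussianPDFReal_mul_le (m : ℝ) (v : NNReal) (hw : Continuous w)
    (hwD : ∀ x, |w x| ≤ D) (s : Set ℝ) :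
    |∫ t in s, gaussianPDFReal m v t * w t| ≤ D * ∫ t in s, gaussianPDFReal m v t := by
  rw [← integral_const_mul]
  refine abs_integral_le_integral_abs.trans <|
    integral_mono (integrable_gaussianPDFReal_mul m v hw hwD).abs.integrableOn
      ((integrable_gaussianPDFReal m v).const_mul D).integrableOn fun t => ?_
  have hφ := gaussianPDFReal_nonneg m v t
  simp only [abs_mul, abs_of_nonneg hφ, mul_comm D]
  exact mul_le_mul_of_nonneg_left (hwD t) hφ

theorem abs_integral_Iic_gaussianPDFReal_mul_le (hv : v ≠ 0) (hw : Continuous w)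
    (hwD : ∀ x, |w x| ≤ D) (hw0 : ∫ t, w t ∂gaussianReal m v = 0) (x : ℝ) :
    |∫ t in Set.Iic x, gaussianPDFReal m v t * w t| ≤
      D * ∫ t in Set.Ioi (m + |x - m|), gaussianPDFReal m v t := by
  -- As `w` has mean zero, `Iic x` may be replaced by `Ioi x`: use the tail not containing `m`.
  rcases le_total m x with hx | hx
  · have hint := integrable_gaussianPDFReal_mul m v hw hwD
    have hsplit := intervalIntegral.integral_Iic_add_Ioi (b := x) hint.integrableOn
      hint.integrableOn
    simp only [integral_gaussianReal_eq_integral_smul hv, smul_eq_mul] at hw0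
    rw [hw0] at hsplit
    rw [eq_neg_of_add_eq_zero_left hsplit, abs_neg, abs_of_nonneg (sub_nonneg.mpr hx),
      add_sub_cancel]
    exact abs_setIntegral_gaussianPDFReal_mul_le m v hw hwD _
  · rw [abs_of_nonpos (sub_nonpos.mpr hx), show m + -(x - m) = 2 * m - x by ring,
      ← integral_Iic_gaussianPDFReal]
    exact abs_setIntegral_gaussianPDFReal_mul_le m v hw hwD _

theorem hasDerivAt_gaussianSteinSolution (hv : v ≠ 0) (hw : Continuous w)
    (hwD : ∀ x, |w x| ≤ D) (x : ℝ) :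
    HasDerivAt (gaussianSteinSolution m v w)
      ((w x + (x - m) * gaussianSteinSolution m v w x) / v) x := by
  have hφ := (gaussianPDFReal_pos m v x hv).ne'
  have hnum := hasDerivAt_integral_Iic ((continuous_gaussianPDFReal m v).fun_mul hw)
    (integrable_gaussianPDFReal_mul m v hw hwD) x
  have hden := (hasDerivAt_gaussianPDFReal m v x).const_mul (v : ℝ)
  refine (hnum.div hden (by positivity)).congr_deriv ?_
  rw [gaussianSteinSolution]
  field_simp
  ring

theorem gaussianSteinOp_gaussianSteinSolution (hv : v ≠ 0) (hw : Continuous w)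
    (hwD : ∀ x, |w x| ≤ D) : gaussianSteinOp m v (gaussianSteinSolution m v w) = w := by
  ext x
  rw [gaussianSteinOp, (hasDerivAt_gaussianSteinSolution hv hw hwD x).deriv]
  field_simp
  ring

theorem contDiff_gaussianSteinSolution (hv : v ≠ 0) (hw : Continuous w)
    (hwD : ∀ x, |w x| ≤ D) : ContDiff ℝ 1 (gaussianSteinSolution m v w) := by
  have hderiv := hasDerivAt_gaussianSteinSolution (m := m) hv hw hwD
  have hdiff : Differentiable ℝ (gaussianSteinSolution m v w) :=
    fun x => (hderiv x).differentiableAt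
  rw [contDiff_one_iff_deriv, funext fun x => (hderiv x).deriv]
  have hcont := hdiff.continuous
  exact ⟨hdiff, by fun_prop⟩

theorem abs_gaussianSteinSolution_le_integral_Ioi (hv : v ≠ 0) (hw : Continuous w)
    (hwD : ∀ x, |w x| ≤ D) (hw0 : ∫ t, w t ∂gaussianReal m v = 0) (x : ℝ) :
    |gaussianSteinSolution m v w x| ≤
      D * (∫ t in Set.Ioi (m + |x - m|), gaussianPDFReal m v t) /
        (v * gaussianPDFReal m v (m + |x - m|)) := by
  have hφ := gaussianPDFReal_pos m v x hv
  rw [gaussianPDFReal_add_abs_sub, gaussianSteinSolution, abs_div,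
    abs_of_nonneg (by positivity : 0 ≤ v * gaussianPDFReal m v x)]
  gcongr
  exact abs_integral_Iic_gaussianPDFReal_mul_le hv hw hwD hw0 x

theorem abs_gaussianSteinSolution_le (hv : v ≠ 0) (hw : Continuous w)
    (hwD : ∀ x, |w x| ≤ D) (hw0 : ∫ t, w t ∂gaussianReal m v = 0) (x : ℝ) :
    |gaussianSteinSolution m v w x| ≤ D * √(Real.pi / 2 / v) := by
  have hD : 0 ≤ D := (abs_nonneg _).trans (hwD 0)
  have hv0 : (0 : ℝ) < v := NNReal.coe_pos.mpr hv.bot_lt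
  have hφ := gaussianPDFReal_pos m v (m + |x - m|) hv
  refine (abs_gaussianSteinSolution_le_integral_Ioi hv hw hwD hw0 x).trans ?_
  have htail := integral_Ioi_gaussianPDFReal_le hv
    (le_add_of_nonneg_right (abs_nonneg (x - m)) : m ≤ m + |x - m|)
  have hsqrt : √(Real.pi / 2 * v) = √(Real.pi / 2 / v) * v := by
    rw [show Real.pi / 2 * v = Real.pi / 2 / v * v ^ 2 by field_simp,
      Real.sqrt_mul (by positivity), Real.sqrt_sq hv0.le]
  rw [div_le_iff₀ (by positivity), mul_assoc D, ← mul_assoc (√_), ← hsqrt]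
  exact mul_le_mul_of_nonneg_left htail hD

theorem abs_sub_mul_gaussianSteinSolution_le (hv : v ≠ 0) (hw : Continuous w)
    (hwD : ∀ x, |w x| ≤ D) (hw0 : ∫ t, w t ∂gaussianReal m v = 0) (x : ℝ) :
    |(x - m) * gaussianSteinSolution m v w x| ≤ D := by
  have hD : 0 ≤ D := (abs_nonneg _).trans (hwD 0)
  have : (0 : ℝ) < v := NNReal.coe_pos.mpr hv.bot_lt
  have hφ := gaussianPDFReal_pos m v (m + |x - m|) hv
  have hmills := sub_mul_integral_Ioi_gaussianPDFReal_le hv (m + |x - m|) (m := m)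
  rw [add_sub_cancel_left] at hmills
  calc |(x - m) * gaussianSteinSolution m v w x|
      = |x - m| * |gaussianSteinSolution m v w x| := abs_mul _ _
    _ ≤ |x - m| * (D * (∫ t in Set.Ioi (m + |x - m|), gaussianPDFReal m v t) /
          (v * gaussianPDFReal m v (m + |x - m|))) := by
        gcongr
        exact abs_gaussianSteinSolution_le_integral_Ioi hv hw hwD hw0 x
    _ = D * (|x - m| * ∫ t in Set.Ioi (m + |x - m|), gaussianPDFReal m v t) /
          (v * gaussianPDFReal m v (m + |x - m|)) := by ring
    _ ≤ D := by
        rw [div_le_iff₀ (by positivity)]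
        gcongr

theorem lipschitzWith_gaussianSteinSolution (hv : v ≠ 0) (hw : Continuous w)
    (hwD : ∀ x, |w x| ≤ D) (hw0 : ∫ t, w t ∂gaussianReal m v = 0) :
    LipschitzWith (2 * D.toNNReal / v) (gaussianSteinSolution m v w) := by
  have hD : 0 ≤ D := (abs_nonneg _).trans (hwD 0)
  have hderiv := hasDerivAt_gaussianSteinSolution (m := m) hv hw hwD
  refine lipschitzWith_of_nnnorm_deriv_le (fun x => (hderiv x).differentiableAt) fun x => ?_
  rw [← NNReal.coe_le_coe, coe_nnnorm, (hderiv x).deriv, norm_div, Real.norm_eq_abs,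
    Real.norm_of_nonneg v.coe_nonneg]
  push_cast [Real.coe_toNNReal _ hD]
  gcongr
  calc |w x + (x - m) * gaussianSteinSolution m v w x|
      ≤ |w x| + |(x - m) * gaussianSteinSolution m v w x| := abs_add_le _ _
    _ ≤ 2 * D := by
        linarith [hwD x, abs_sub_mul_gaussianSteinSolution_le hv hw hwD hw0 x]

theorem tvNorm_sub_gaussianReal_le_of_stein {ρ : Measure ℝ} [IsProbabilityMeasure ρ] (hv : v ≠ 0)
    {ε : ℝ} (h : ∀ F : ℝ → ℝ, ContDiff ℝ 1 F → (∀ x, |F x| ≤ 2 * √(Real.pi / 2 / v)) →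
      LipschitzWith (4 / v) F → Integrable (gaussianSteinOp m v F) ρ →
        |∫ x, gaussianSteinOp m v F x ∂ρ| ≤ ε) :
    tvNorm (ρ.toSignedMeasure - (gaussianReal m v).toSignedMeasure) ≤ ε := by
  refine tvNorm_le_of_forall_continuous fun f hf hf1 => ?_
  have hfi (κ : Measure ℝ) [IsFiniteMeasure κ] : Integrable f κ :=
    .of_bound hf.aestronglyMeasurable 1 (.of_forall hf1)
  set c := ∫ x, f x ∂gaussianReal m v
  have hc : |c| ≤ 1 := by
    simpa [c] using
      norm_integral_le_of_norm_le_const (μ := gaussianReal m v) (f := f) (.of_forall hf1)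
  have hw : Continuous fun x => f x - c := by fun_prop
  have hw2 (x : ℝ) : |f x - c| ≤ 2 := (abs_sub _ _).trans (by linarith [hf1 x])
  have hw0 : ∫ x, (f x - c) ∂gaussianReal m v = 0 := by
    rw [integral_sub (hfi _) (integrable_const _), integral_const, probReal_univ, one_smul,
      sub_self]
  have hlip : LipschitzWith (4 / v) (gaussianSteinSolution m v fun x => f x - c) := by
    simpa [show (2 * 2 : NNReal) = 4 by norm_num] using
      lipschitzWith_gaussianSteinSolution hv hw hw2 hw0
  have hstein := h _ (contDiff_gaussianSteinSolution hv hw hw2)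
    (abs_gaussianSteinSolution_le hv hw hw2 hw0) hlip
  rw [gaussianSteinOp_gaussianSteinSolution hv hw hw2, integral_sub (hfi ρ) (integrable_const c),
    integral_const, probReal_univ, one_smul] at hstein
  exact hstein ((hfi ρ).sub (integrable_const c))

end SteinSolution

theorem integral_abs_sub_integral_le_sqrt_variance {Ω : Type*} [MeasurableSpace Ω] {μ : Measure Ω}
    [IsProbabilityMeasure μ] {X : Ω → ℝ} (hX : MemLp X 2 μ) :
    ∫ ω, |X ω - μ[X]| ∂μ ≤ √Var[X; μ] := by
  have hcentered : MemLp (fun ω => |X ω - μ[X]|) 2 μ := (hX.sub (memLp_const _)).abs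
  have hvar := variance_eq_sub hcentered ▸ variance_nonneg _ μ
  rw [variance_eq_integral hX.aemeasurable]
  refine Real.le_sqrt_of_sq_le ?_
  simpa only [Pi.pow_apply, sq_abs] using sub_nonneg.mp hvar

section NegativeBinomial

variable {r p : ℝ}

theorem negBinPMFReal_nonneg (hr : 0 < r) (hp0 : 0 < p) (hp1 : p < 1) (k : ℕ) :
    0 ≤ negBinPMFReal r p k := by
  have := Real.Gamma_pos_of_pos hr
  have : 0 < Real.Gamma (r + k) := Real.Gamma_pos_of_pos (by positivity)
  have : 0 ≤ (1 - p) ^ r := Real.rpow_nonneg (sub_nonneg.mpr hp1.le) r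
  unfold negBinPMFReal
  positivity

theorem succ_mul_negBinPMFReal_succ (hr : 0 < r) (p : ℝ) (k : ℕ) :
    (k + 1) * negBinPMFReal r p (k + 1) = p * (r + k) * negBinPMFReal r p k := by
  have hΓ := (Real.Gamma_pos_of_pos hr).ne'
  have hrk : r + k ≠ 0 := by positivity
  unfold negBinPMFReal
  rw [Nat.factorial_succ, Nat.cast_mul, Nat.cast_succ, ← add_assoc, Real.Gamma_add_one hrk]
  field_simp
  ring

theorem add_mul_negBinPMFReal (hr : 0 < r) (hp1 : p < 1) (k : ℕ) :
    (r + k) * negBinPMFReal r p k = r / (1 - p) * negBinPMFReal (r + 1) p k := by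
  have hΓ := (Real.Gamma_pos_of_pos hr).ne'
  have hrk : r + k ≠ 0 := by positivity
  have hq : 0 < 1 - p := sub_pos.mpr hp1
  unfold negBinPMFReal
  rw [add_right_comm r 1 (k : ℝ), Real.Gamma_add_one hrk, Real.Gamma_add_one hr.ne',
    Real.rpow_add hq, Real.rpow_one]
  field_simp

theorem integral_negBinMeasure (hr : 0 < r) (hp0 : 0 < p) (hp1 : p < 1) (f : ℕ → ℝ) :
    ∫ k, f k ∂negBinMeasure r p = ∑' k, negBinPMFReal r p k * f k := by
  simp only [negBinMeasure, integral_sum_dirac fun _ => ENNReal.ofReal_ne_top,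
    ENNReal.toReal_ofReal (negBinPMFReal_nonneg hr hp0 hp1 _), smul_eq_mul]

theorem integrable_negBinMeasure_iff (hr : 0 < r) (hp0 : 0 < p) (hp1 : p < 1) {f : ℕ → ℝ} :
    Integrable f (negBinMeasure r p) ↔ Summable fun k => negBinPMFReal r p k * f k := by
  rw [negBinMeasure, integrable_sum_dirac_iff fun _ => ENNReal.ofReal_ne_top,
    ← summable_abs_iff (f := fun k => negBinPMFReal r p k * f k)]
  simp only [ENNReal.toReal_ofReal (negBinPMFReal_nonneg hr hp0 hp1 _), abs_mul,
    abs_of_nonneg (negBinPMFReal_nonneg hr hp0 hp1 _), Real.norm_eq_abs]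

theorem integral_add_natCast_mul_negBinMeasure (hr : 0 < r) (hp0 : 0 < p) (hp1 : p < 1)
    (f : ℕ → ℝ) :
    ∫ k, (r + k) * f k ∂negBinMeasure r p = r / (1 - p) * ∫ k, f k ∂negBinMeasure (r + 1) p := by
  rw [integral_negBinMeasure hr hp0 hp1, integral_negBinMeasure (by positivity) hp0 hp1,
    ← tsum_mul_left]
  congr with k
  linear_combination f k * add_mul_negBinPMFReal hr hp1 k

theorem integrable_add_natCast_mul_negBinMeasure_iff (hr : 0 < r) (hp0 : 0 < p) (hp1 : p < 1)
    {f : ℕ → ℝ} :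
    Integrable (fun k : ℕ => (r + k) * f k) (negBinMeasure r p) ↔
      Integrable f (negBinMeasure (r + 1) p) := by
  have hrq : r / (1 - p) ≠ 0 := (div_pos hr (sub_pos.mpr hp1)).ne'
  rw [integrable_negBinMeasure_iff hr hp0 hp1,
    integrable_negBinMeasure_iff (by positivity) hp0 hp1,
    ← summable_mul_left_iff (f := fun k => negBinPMFReal (r + 1) p k * f k) hrq]
  congr! 2 with k
  linear_combination f k * add_mul_negBinPMFReal hr hp1 k

theorem integral_mul_add_mul_succ_negBinMeasure (hr : 0 < r) (hp0 : 0 < p) (hp1 : p < 1)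
    (g : ℕ → ℝ) :
    ∫ k : ℕ, p * (r + k) * g (k + 1) ∂negBinMeasure r p =
      ∫ k : ℕ, k * g k ∂negBinMeasure r p := by
  rw [integral_negBinMeasure hr hp0 hp1, integral_negBinMeasure hr hp0 hp1]
  have hsupport : Function.support (fun k : ℕ => negBinPMFReal r p k * (k * g k)) ⊆
      Set.range Nat.succ := by
    rintro (_ | k) hk
    · simp at hk
    · exact ⟨k, rfl⟩
  rw [← Nat.succ_injective.tsum_eq hsupport]
  congr with k
  push_cast [Nat.succ_eq_add_one]
  linear_combination -g (k + 1) * succ_mul_negBinPMFReal_succ hr p k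

theorem integrable_natCast_negBinMeasure (hr : 0 < r) (hp0 : 0 < p) (hp1 : p < 1) :
    Integrable (fun k : ℕ => (k : ℝ)) (negBinMeasure r p) := by
  have := isProbabilityMeasure_negBinMeasure hr hp0 hp1
  have := isProbabilityMeasure_negBinMeasure (by positivity : 0 < r + 1) hp0 hp1
  have hadd := (integrable_add_natCast_mul_negBinMeasure_iff hr hp0 hp1).mpr
    (integrable_const (1 : ℝ))
  simpa [Pi.sub_def] using hadd.sub (integrable_const r)

theorem integral_natCast_negBinMeasure (hr : 0 < r) (hp0 : 0 < p) (hp1 : p < 1) :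
    ∫ k, (k : ℝ) ∂negBinMeasure r p = r * p / (1 - p) := by
  have := isProbabilityMeasure_negBinMeasure hr hp0 hp1
  have := isProbabilityMeasure_negBinMeasure (by positivity : 0 < r + 1) hp0 hp1
  have hq : 1 - p ≠ 0 := (sub_pos.mpr hp1).ne'
  have hadd := integral_add_natCast_mul_negBinMeasure hr hp0 hp1 fun _ => 1
  simp only [mul_one, integral_const, probReal_univ, smul_eq_mul] at hadd
  rw [integral_add (integrable_const r) (integrable_natCast_negBinMeasure hr hp0 hp1),
    integral_const, probReal_univ, one_smul] at hadd
  rw [eq_sub_of_add_eq' hadd]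
  field_simp
  ring

theorem memLp_two_natCast_negBinMeasure (hr : 0 < r) (hp0 : 0 < p) (hp1 : p < 1) :
    MemLp (fun k : ℕ => (k : ℝ)) 2 (negBinMeasure r p) := by
  have := isProbabilityMeasure_negBinMeasure hr hp0 hp1
  have := isProbabilityMeasure_negBinMeasure (by positivity : 0 < r + 1) hp0 hp1
  have hsq : Integrable (fun k : ℕ => (r + k) * (r + k)) (negBinMeasure r p) :=
    (integrable_add_natCast_mul_negBinMeasure_iff hr hp0 hp1).mpr
      ((integrable_const r).add (integrable_natCast_negBinMeasure (by positivity) hp0 hp1))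
  simp only [← pow_two] at hsq
  have hadd := (memLp_two_iff_integrable_sq Measurable.of_discrete.aestronglyMeasurable).mpr hsq
  simpa [Pi.sub_def] using hadd.sub (memLp_const r)

theorem variance_natCast_negBinMeasure (hr : 0 < r) (hp0 : 0 < p) (hp1 : p < 1) :
    Var[fun k : ℕ => (k : ℝ); negBinMeasure r p] = r * p / (1 - p) ^ 2 := by
  have := isProbabilityMeasure_negBinMeasure hr hp0 hp1
  have hq : 1 - p ≠ 0 := (sub_pos.mpr hp1).ne'
  have hK := memLp_two_natCast_negBinMeasure hr hp0 hp1
  have integral_add_natCast {s : ℝ} (hs : 0 < s) (c : ℝ) :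
      ∫ k : ℕ, (c + k) ∂negBinMeasure s p = c + s * p / (1 - p) := by
    have := isProbabilityMeasure_negBinMeasure hs hp0 hp1
    rw [integral_add (integrable_const c) (integrable_natCast_negBinMeasure hs hp0 hp1),
      integral_const, probReal_univ, one_smul, integral_natCast_negBinMeasure hs hp0 hp1]
  -- Weighting by `r + k` turns `NegBin(r, p)` into a multiple of `NegBin(r + 1, p)`, which reduces
  -- the second moment of `r + K` to a first moment.
  have hrK : MemLp (fun k : ℕ => r + (k : ℝ)) 2 (negBinMeasure r p) := (memLp_const r).add hK
  rw [← variance_const_add hK.aestronglyMeasurable r, variance_eq_sub hrK]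
  simp only [Pi.pow_apply, pow_two (r + _)]
  rw [integral_add_natCast_mul_negBinMeasure hr hp0 hp1, integral_add_natCast (by positivity),
    integral_add_natCast hr]
  field_simp
  ring

end NegativeBinomial

section Jitter

/-- The law of `K + U`, where `K` has law `κ` and `U` is an independent uniform variable on
`(-1/2, 1/2)`. It spreads the mass of each `k` evenly over the cell of length one around `k`. -/
noncomputable def jitter (κ : Measure ℕ) : Measure ℝ :=
  κ.map (Nat.cast : ℕ → ℝ) ∗ volume.restrict (Set.Ioo (-1 / 2 : ℝ) (1 / 2))

variable {κ : Measure ℕ}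

instance isProbabilityMeasure_jitter [IsProbabilityMeasure κ] :
    IsProbabilityMeasure (jitter κ) := by
  have := Measure.isProbabilityMeasure_map (μ := κ) (f := (Nat.cast : ℕ → ℝ)) (by fun_prop)
  have : IsProbabilityMeasure (volume.restrict (Set.Ioo (-1 / 2 : ℝ) (1 / 2))) :=
    ⟨by rw [Measure.restrict_apply_univ, Real.volume_Ioo]; norm_num⟩
  unfold jitter
  infer_instance

theorem map_natCast_add_eq_jitter {Ω : Type*} [MeasurableSpace Ω] {P : Measure Ω}
    [IsProbabilityMeasure P] {K : Ω → ℕ} {U : Ω → ℝ} (hK : HasLaw K κ P)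
    (hU : pdf.IsUniform U (Set.Ioo (-1 / 2 : ℝ) (1 / 2)) P volume) (hKU : IndepFun K U P) :
    P.map (fun ω => (K ω : ℝ) + U ω) = jitter κ := by
  have hUlaw : HasLaw U (volume.restrict (Set.Ioo (-1 / 2 : ℝ) (1 / 2))) P := by
    refine ⟨hU.aemeasurable (by rw [Real.volume_Ioo]; norm_num) (by simp), ?_⟩
    rw [hU, ProbabilityTheory.cond, Real.volume_Ioo]
    norm_num
  have hKlaw : HasLaw (fun ω => (K ω : ℝ)) (κ.map (Nat.cast : ℕ → ℝ)) P :=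
    HasLaw.comp ⟨by fun_prop, rfl⟩ hK
  have hindep : IndepFun (fun ω => (K ω : ℝ)) U P :=
    hKU.comp (φ := Nat.cast) (by fun_prop) measurable_id
  have := hKlaw.isProbabilityMeasure_iff.mp inferInstance
  exact (hindep.hasLaw_fun_add hKlaw hUlaw).map_eq

theorem jitter_apply [SFinite κ] {B : Set ℝ} (hB : MeasurableSet B) :
    jitter κ B = ∫⁻ k : ℕ, ∫⁻ u in Set.Ioo (-1 / 2 : ℝ) (1 / 2),
      B.indicator (fun _ => 1) ((k : ℝ) + u) ∂volume ∂κ := by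
  have hind : Measurable (B.indicator fun _ => (1 : ENNReal)) := measurable_const.indicator hB
  rw [← lintegral_indicator_one hB, jitter]
  refine (Measure.lintegral_conv hind).trans (lintegral_map ?_ (by fun_prop))
  fun_prop

theorem integral_jitter [SFinite κ] {h : ℝ → ℝ} (hh : Integrable h (jitter κ)) :
    ∫ x, h x ∂jitter κ = ∫ k : ℕ, (∫ x in (k - 1 / 2 : ℝ)..(k + 1 / 2), h x) ∂κ := by
  rw [jitter, integral_conv hh,
    Nat.isClosedEmbedding_coe_real.measurableEmbedding.integral_map]
  congr with k
  rw [← integral_Ioc_eq_integral_Ioo, ← intervalIntegral.integral_of_le (by norm_num),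
    intervalIntegral.integral_comp_add_left]
  congr 1
  ring

end Jitter

section SteinBound

theorem abs_integral_cell_sub_le {F : ℝ → ℝ} {L : NNReal} {A : ℝ} (hF : LipschitzWith L F)
    (hA : ∀ x, |F x| ≤ A) (m k : ℝ) :
    |(∫ x in (k - 1 / 2)..(k + 1 / 2), (x - m) * F x) - (k - m) * F (k - 1 / 2)| ≤
      L * |k - m| + A / 2 := by
  have hFc := hF.continuous
  have hdiff : (∫ x in (k - 1 / 2)..(k + 1 / 2), (x - m) * F x) - (k - m) * F (k - 1 / 2) =
      ∫ x in (k - 1 / 2)..(k + 1 / 2), ((k - m) * (F x - F (k - 1 / 2)) + (x - k) * F x) := by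
    have hconst : (k - m) * F (k - 1 / 2) =
        ∫ _ in (k - 1 / 2)..(k + 1 / 2), (k - m) * F (k - 1 / 2) := by
      rw [intervalIntegral.integral_const, smul_eq_mul]
      ring
    rw [hconst, ← intervalIntegral.integral_sub (Continuous.intervalIntegrable (by fun_prop) _ _)
      (Continuous.intervalIntegrable (by fun_prop) _ _)]
    congr with x
    ring
  have hintegrand (x : ℝ) (hx : x ∈ Set.uIoc (k - 1 / 2) (k + 1 / 2)) :
      ‖(k - m) * (F x - F (k - 1 / 2)) + (x - k) * F x‖ ≤ L * |k - m| + A / 2 := by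
    rw [Set.uIoc_of_le (by linarith)] at hx
    have hx_left : |x - (k - 1 / 2)| ≤ 1 := abs_le.mpr ⟨by linarith [hx.1], by linarith [hx.2]⟩
    have hx_mid : |x - k| ≤ 1 / 2 := abs_le.mpr ⟨by linarith [hx.1], by linarith [hx.2]⟩
    have hincrement : |F x - F (k - 1 / 2)| ≤ L :=
      (hF.dist_le_mul x _).trans (mul_le_of_le_one_right L.coe_nonneg hx_left)
    calc |(k - m) * (F x - F (k - 1 / 2)) + (x - k) * F x|
        ≤ |F x - F (k - 1 / 2)| * |k - m| + |F x| * |x - k| :=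
          (abs_add_le _ _).trans_eq (by rw [abs_mul, abs_mul, mul_comm, mul_comm |x - k|])
      _ ≤ L * |k - m| + A * (1 / 2) := by
          have hA0 := (abs_nonneg _).trans (hA x)
          gcongr
          exact hA x
      _ = L * |k - m| + A / 2 := by ring
  have hbound := intervalIntegral.norm_integral_le_of_norm_le_const hintegrand
  have hlength : |k + 1 / 2 - (k - 1 / 2)| = 1 := by norm_num [abs_of_pos]
  rwa [Real.norm_eq_abs, hlength, mul_one, ← hdiff] at hbound

theorem integral_cell_gaussianSteinOp {F : ℝ → ℝ} (hF : ContDiff ℝ 1 F) (m v k : ℝ) :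
    ∫ x in (k - 1 / 2)..(k + 1 / 2), gaussianSteinOp m v F x =
      v * (F (k + 1 / 2) - F (k - 1 / 2)) -
        ∫ x in (k - 1 / 2)..(k + 1 / 2), (x - m) * F x := by
  have hFc := hF.continuous
  have hF'c := hF.continuous_deriv_one
  simp only [gaussianSteinOp]
  rw [intervalIntegral.integral_sub (Continuous.intervalIntegrable (by fun_prop) _ _)
    (Continuous.intervalIntegrable (by fun_prop) _ _), intervalIntegral.integral_const_mul,
    intervalIntegral.integral_deriv_eq_sub
      (fun x _ => (hF.differentiable one_ne_zero).differentiableAt)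
      (hF'c.intervalIntegrable _ _)]

/-- The Stein operator `g ↦ p (r + k) g(k + 1) - k g(k)` of `NegBin(r, p)`, evaluated at
`g k = F (k - 1/2)`, so that the values involved are those at the endpoints of the cell of `k`. -/
noncomputable def negBinSteinOp (r p : ℝ) (F : ℝ → ℝ) (k : ℕ) : ℝ :=
  p * (r + k) * F (k + 1 / 2) - k * F (k - 1 / 2)

variable {r p : ℝ} {F : ℝ → ℝ} {L : NNReal} {A : ℝ}

theorem integrable_and_integral_negBinSteinOp_eq_zero (hr : 0 < r) (hp0 : 0 < p) (hp1 : p < 1)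
    (hA : ∀ x, |F x| ≤ A) :
    Integrable (negBinSteinOp r p F) (negBinMeasure r p) ∧
      ∫ k, negBinSteinOp r p F k ∂negBinMeasure r p = 0 := by
  have := isProbabilityMeasure_negBinMeasure hr hp0 hp1
  have hK := integrable_natCast_negBinMeasure hr hp0 hp1
  have hdiscrete (f : ℕ → ℝ) : AEStronglyMeasurable f (negBinMeasure r p) :=
    Measurable.of_discrete.aestronglyMeasurable
  have hupper : Integrable (fun k : ℕ => p * (r + k) * F (k + 1 / 2)) (negBinMeasure r p) :=
    (((integrable_const r).add hK).const_mul p).mul_bdd (hdiscrete _) (.of_forall fun _ => hA _)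
  have hlower : Integrable (fun k : ℕ => k * F (k - 1 / 2)) (negBinMeasure r p) :=
    hK.mul_bdd (hdiscrete _) (.of_forall fun _ => hA _)
  have hidentity := integral_mul_add_mul_succ_negBinMeasure hr hp0 hp1 fun k => F (k - 1 / 2)
  have hshift (k : ℕ) : ((k + 1 : ℕ) : ℝ) - 1 / 2 = k + 1 / 2 := by push_cast; ring
  simp only [hshift] at hidentity
  refine ⟨hupper.sub hlower, ?_⟩
  simp only [negBinSteinOp]
  rw [integral_sub hupper hlower, hidentity, sub_self]

theorem abs_integral_cell_gaussianSteinOp_sub_negBinSteinOp_le (hp0 : 0 < p) (hp1 : p < 1)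
    (hF : ContDiff ℝ 1 F) (hFL : LipschitzWith L F) (hA : ∀ x, |F x| ≤ A) (k : ℕ) :
    |(∫ x in (k - 1 / 2 : ℝ)..(k + 1 / 2),
        gaussianSteinOp (r * p / (1 - p)) (r * p / (1 - p) ^ 2) F x) -
        negBinSteinOp r p F k / (1 - p)| ≤
      L / (1 - p) * |k - r * p / (1 - p)| + A / 2 := by
  have hq : 0 < 1 - p := sub_pos.mpr hp1
  have hcell := abs_integral_cell_sub_le hFL hA (r * p / (1 - p)) k
  have hincrement : |F (k + 1 / 2) - F (k - 1 / 2)| ≤ L := by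
    have hdist : dist (k + 1 / 2 : ℝ) (k - 1 / 2) = 1 := by rw [Real.dist_eq]; norm_num
    simpa only [hdist, mul_one, Real.dist_eq (F _)] using
      hFL.dist_le_mul (k + 1 / 2 : ℝ) (k - 1 / 2)
  rw [integral_cell_gaussianSteinOp hF, negBinSteinOp]
  generalize ∫ x in (k - 1 / 2 : ℝ)..(k + 1 / 2), (x - r * p / (1 - p)) * F x = I at hcell ⊢
  calc _ = |p / (1 - p) * ((k - r * p / (1 - p)) * (F (k + 1 / 2) - F (k - 1 / 2))) +
        (I - (k - r * p / (1 - p)) * F (k - 1 / 2))| := by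
        rw [← abs_neg]
        congr 1
        field_simp
        ring
    _ ≤ p / (1 - p) * (|k - r * p / (1 - p)| * |F (k + 1 / 2) - F (k - 1 / 2)|) +
        |I - (k - r * p / (1 - p)) * F (k - 1 / 2)| :=
        (abs_add_le _ _).trans_eq (by rw [abs_mul, abs_mul, abs_of_pos (div_pos hp0 hq)])
    _ ≤ p / (1 - p) * (|k - r * p / (1 - p)| * L) + (L * |k - r * p / (1 - p)| + A / 2) := by
        gcongr
    _ = L / (1 - p) * |k - r * p / (1 - p)| + A / 2 := by
        field_simp
        ring

theorem abs_integral_jitter_gaussianSteinOp_le (hr : 0 < r) (hp0 : 0 < p) (hp1 : p < 1)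
    (hF : ContDiff ℝ 1 F) (hFL : LipschitzWith L F) (hA : ∀ x, |F x| ≤ A)
    (hint : Integrable (gaussianSteinOp (r * p / (1 - p)) (r * p / (1 - p) ^ 2) F)
      (jitter (negBinMeasure r p))) :
    |∫ x, gaussianSteinOp (r * p / (1 - p)) (r * p / (1 - p) ^ 2) F x
        ∂jitter (negBinMeasure r p)| ≤
      L / (1 - p) * √(r * p / (1 - p) ^ 2) + A / 2 := by
  have := isProbabilityMeasure_negBinMeasure hr hp0 hp1
  set G : ℕ → ℝ := fun k => ∫ x in (k - 1 / 2 : ℝ)..(k + 1 / 2),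
    gaussianSteinOp (r * p / (1 - p)) (r * p / (1 - p) ^ 2) F x
  set S : ℕ → ℝ := fun k => negBinSteinOp r p F k / (1 - p)
  have hS : Integrable S (negBinMeasure r p) :=
    (integrable_and_integral_negBinSteinOp_eq_zero hr hp0 hp1 hA).1.div_const _
  have hS0 : ∫ k, S k ∂negBinMeasure r p = 0 := by
    rw [integral_div, (integrable_and_integral_negBinSteinOp_eq_zero hr hp0 hp1 hA).2, zero_div]
  have hbound (k : ℕ) : |G k - S k| ≤ L / (1 - p) * |k - r * p / (1 - p)| + A / 2 :=
    abs_integral_cell_gaussianSteinOp_sub_negBinSteinOp_le hp0 hp1 hF hFL hA k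
  have hdev : Integrable (fun k : ℕ => L / (1 - p) * |k - r * p / (1 - p)|) (negBinMeasure r p) :=
    ((integrable_natCast_negBinMeasure hr hp0 hp1).sub (integrable_const _)).abs.const_mul _
  have hGS : Integrable (fun k => G k - S k) (negBinMeasure r p) :=
    (hdev.add (integrable_const _)).mono' Measurable.of_discrete.aestronglyMeasurable
      (.of_forall hbound)
  have hG : ∫ k, G k ∂negBinMeasure r p = ∫ k, (G k - S k) ∂negBinMeasure r p := by
    have hsum := integral_add hGS hS
    simp only [sub_add_cancel] at hsum
    rw [hsum, hS0, add_zero]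
  have hmad := integral_abs_sub_integral_le_sqrt_variance
    (memLp_two_natCast_negBinMeasure hr hp0 hp1)
  rw [integral_natCast_negBinMeasure hr hp0 hp1, variance_natCast_negBinMeasure hr hp0 hp1] at hmad
  have : 0 ≤ 1 - p := sub_nonneg.mpr hp1.le
  calc |∫ x, gaussianSteinOp (r * p / (1 - p)) (r * p / (1 - p) ^ 2) F x
        ∂jitter (negBinMeasure r p)|
      = |∫ k, (G k - S k) ∂negBinMeasure r p| := by rw [integral_jitter hint, ← hG]
    _ ≤ ∫ k, |G k - S k| ∂negBinMeasure r p := abs_integral_le_integral_abs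
    _ ≤ ∫ k : ℕ, (L / (1 - p) * |k - r * p / (1 - p)| + A / 2) ∂negBinMeasure r p :=
        integral_mono hGS.abs (hdev.add (integrable_const _)) hbound
    _ = L / (1 - p) * ∫ k : ℕ, |k - r * p / (1 - p)| ∂negBinMeasure r p + A / 2 := by
        rw [integral_add hdev (integrable_const _), integral_const_mul, integral_const,
          probReal_univ, one_smul]
    _ ≤ L / (1 - p) * √(r * p / (1 - p) ^ 2) + A / 2 := by gcongr

theorem tvNorm_jitter_negBinMeasure_sub_gaussianReal_le (hr : 0 < r) (hp0 : 0 < p) (hp1 : p < 1) :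
    have := isProbabilityMeasure_negBinMeasure hr hp0 hp1
    tvNorm ((jitter (negBinMeasure r p)).toSignedMeasure -
        (gaussianReal (r * p / (1 - p)) (r * p / (1 - p) ^ 2).toNNReal).toSignedMeasure) ≤
      (4 + √(Real.pi / 2) * (1 - p)) / √p * r ^ (-(1 / 2) : ℝ) := by
  intro
  have hq : 0 < 1 - p := sub_pos.mpr hp1
  have hv : 0 < r * p / (1 - p) ^ 2 := by positivity
  have hv_coe : ((r * p / (1 - p) ^ 2).toNNReal : ℝ) = r * p / (1 - p) ^ 2 :=
    Real.coe_toNNReal _ hv.le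
  refine tvNorm_sub_gaussianReal_le_of_stein (Real.toNNReal_pos.mpr hv).ne'
    fun F hF hA hFL hint => ?_
  rw [hv_coe] at hA hint ⊢
  refine (abs_integral_jitter_gaussianSteinOp_le hr hp0 hp1 hF hFL hA hint).trans_eq ?_
  push_cast [hv_coe]
  have hsd : 1 / √(r * p / (1 - p) ^ 2) = (1 - p) / √p * r ^ (-(1 / 2) : ℝ) := by
    rw [Real.rpow_neg hr.le, ← Real.sqrt_eq_rpow, Real.sqrt_div (by positivity),
      Real.sqrt_mul hr.le, Real.sqrt_sq hq.le]
    field_simp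
  calc 4 / (r * p / (1 - p) ^ 2) / (1 - p) * √(r * p / (1 - p) ^ 2) +
        2 * √(Real.pi / 2 / (r * p / (1 - p) ^ 2)) / 2
      = (4 / (1 - p) + √(Real.pi / 2)) * (1 / √(r * p / (1 - p) ^ 2)) := by
        rw [Real.sqrt_div' _ hv.le]
        linear_combination 4 / (1 - p) * Real.sqrt_div_self' (x := r * p / (1 - p) ^ 2)
    _ = (4 + √(Real.pi / 2) * (1 - p)) / √p * r ^ (-(1 / 2) : ℝ) := by
        rw [hsd]
        field_simp

end SteinBound

theorem mainTheorem5_general {p r : ℝ} (hp0 : 0 < p) (hp1 : p < 1) (hr : 0 < r) {Ω : Type*}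
    [MeasurableSpace Ω] {P : Measure Ω} [IsProbabilityMeasure P] {K : Ω → ℕ} {U : Ω → ℝ}
    (hK : HasLaw K (negBinMeasure r p) P)
    (hU : pdf.IsUniform U (Set.Ioo (-1 / 2 : ℝ) (1 / 2)) P volume) (hKU : IndepFun K U P) :
    (∀ B : Set ℝ, MeasurableSet B →
      P.map (fun ω => (K ω : ℝ) + U ω) B =
        ∫⁻ k : ℕ, ∫⁻ u in Set.Ioo (-1 / 2 : ℝ) (1 / 2),
          B.indicator (fun _ => 1) ((k : ℝ) + u) ∂volume ∂(negBinMeasure r p)) ∧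
    tvNorm ((P.map (fun ω => (K ω : ℝ) + U ω)).toSignedMeasure -
        (gaussianReal (r * p / (1 - p)) (Real.toNNReal (r * p / (1 - p) ^ 2))).toSignedMeasure) ≤
      (4 + √(Real.pi / 2) * (1 - p)) / √p * r ^ (-(1 / 2) : ℝ) := by
  have := isProbabilityMeasure_negBinMeasure hr hp0 hp1
  simp only [map_natCast_add_eq_jitter hK hU hKU]
  exact ⟨fun B hB => jitter_apply hB, tvNorm_jitter_negBinMeasure_sub_gaussianReal_le hr hp0 hp1⟩

theorem mainTheorem5 (p : ℝ) (hp0 : 0 < p) (hp1 : p < 1) :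
    ∃ C : ℝ, 0 < C ∧ ∃ r₀ : ℝ, 0 < r₀ ∧
      ∀ (r : ℝ), 0 < r →
        ∀ (Ω : Type*) [MeasurableSpace Ω] (P : Measure Ω) [IsProbabilityMeasure P]
          (K : Ω → ℕ) (U : Ω → ℝ),
          HasLaw K (negBinMeasure r p) P →
          AEMeasurable U P →
          pdf.IsUniform U (Set.Ioo (-1 / 2 : ℝ) (1 / 2)) P volume →
          IndepFun K U P →
          (∀ B : Set ℝ, MeasurableSet B →
            P.map (fun ω => (K ω : ℝ) + U ω) B =
              ∫⁻ k : ℕ, ∫⁻ u in Set.Ioo (-1 / 2 : ℝ) (1 / 2),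
                B.indicator (fun _ => 1) ((k : ℝ) + u) ∂volume ∂(negBinMeasure r p)) ∧
          (r₀ ≤ r →
            tvNorm ((P.map (fun ω => (K ω : ℝ) + U ω)).toSignedMeasure -
                (gaussianReal (r * p / (1 - p))
                  (Real.toNNReal (r * p / (1 - p) ^ 2))).toSignedMeasure) ≤
              C * r ^ (-(1 / 2) : ℝ)) := by
  have : 0 < 1 - p := sub_pos.mpr hp1
  refine ⟨(4 + √(Real.pi / 2) * (1 - p)) / √p, by positivity, 1, one_pos,
    fun r hr Ω _ P _ K U hK _ hU hKU => ?_⟩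
  exact (mainTheorem5_general hp0 hp1 hr hK hU hKU).imp_right fun htv _ => htv
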